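/- Let $\mathbf{k}$ be a field of characteristic zero and let $q\in\mathbf{k}$ not be a nontrivial root of unity ($q=1$ and $q=0$ are allowed). Let $n\ge 1$ and $\mathbf{x}_n=(x_1,\dots,x_n)$. For a rational function $F\in\mathbf{k}(\mathbf{x}_n)$ put $$\partial_{w_0}F=\frac{\sum_{\sigma\in\mathbb{S}_n}\operatorname{sgn}(\sigma)\,F(x_{\sigma(1)},\dots,x_{\sigma(n)})}{\prod_{1\le i<j\le n}(x_i-x_j)},$$ and for $f\in\mathbf{k}[\mathbf{x}_n]$ define the $q$-divided symmetrization $$\langle f\rangle_n^q=\partial_{w_0}\Bigl(\prod_{1\le i<j\le n}(qx_i-x_j)\cdot\frac{f}{\prod_{1\le i\le n-1}(qx_i-x_{i+1})}\Bigr).$$ Let $\mathrm{QSym}_n^+$ be the ideal of $\mathbf{k}[\mathbf{x}_n]$ generated by the quasisymmetric polynomials without constant term, where a polynomial is quasisymmetric if for all positive integers $\alpha_1,\dots,\alpha_k$ and all $1\le i_1<\dots<i_k\le n$ its coefficients at $x_{i_1}^{\alpha_1}\cdots x_{i_k}^{\alpha_k}$ and at $x_1^{\alpha_1}\cdots x_k^{\alpha_k}$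 agree. Let $$\mathrm{ABB}_n=\Bigl\{(c_1,\dots,c_n)\in\mathbb{N}^n \;:\; \sum_{i\le j\le n}c_j\le n-i\ \text{ for all }1\le i\le n\Bigr\},$$ and let $L_n$ be the $\mathbf{k}$-linear span of the (Aval–Bergeron–Bergeron) monomials $\mathbf{x}^c$ with $c\in \mathrm{ABB}_n$. (1) If $f\in\mathbf{k}[\mathbf{x}_n]$, homogeneous of degree $n-1$, is written $f=g+h$ with $g\in L_n$ and $h\in\mathrm{QSym}_n^+$, then $$\langle f\rangle_n^q=g(1,q,q^2,\dots,q^{n-1}).$$ (2) If $c\in\mathrm{ABB}_n$ and $c_1+\dots+c_n=n-1$ (so that $c_n=0$), then $$\langle \mathbf{x}^c\rangle_n^q=q^{\mathrm{coarea}(\mathsf{Dyck}(c))}.$$ Here $\mathsf{Dyck}(c)$ is the Dyck path $N^{c_1}E\,N^{c_2}E\cdots N^{c_{n-1}}E$ from $(0,0)$ to $(n-1,n-1)$ with unit north steps $N$ and unit east steps $E$, which stays weakly above the diagonal. Its coarea is $\binom{n-1}{2}$ minus the number of unit cells lying between the path and the diagonal, that is, the number of unit cells of the square $[0,n-1]^2$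 that lie above the path. -/

import Mathlib

open MvPolynomial Finset

noncomputable section

/-- The field of rational functions `K(x₁, …, xₙ)`; the variable `xᵢ₊₁` of the literature is
`X i` for `i : Fin n`. -/
abbrev RatFun (K : Type*) [Field K] (n : ℕ) : Type _ :=
  FractionRing (MvPolynomial (Fin n) K)

/-- The `i`-th variable as a rational function. -/
def ratX (K : Type*) [Field K] {n : ℕ} (i : Fin n) : RatFun K n :=
  algebraMap (MvPolynomial (Fin n) K) (RatFun K n) (X i)

/-- The action of the symmetric group on rational functions by permuting the variables,
`xᵢ ↦ x_{σ(i)}`. -/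
def permAct (K : Type*) [Field K] {n : ℕ} (σ : Equiv.Perm (Fin n)) :
    RatFun K n ≃+* RatFun K n :=
  IsFractionRing.ringEquivOfRingEquiv (renameEquiv K σ).toRingEquiv

/-- The divided difference operator `∂_{w₀}` of the longest permutation: antisymmetrization
followed by division by the Vandermonde determinant `∏_{i<j} (xᵢ - xⱼ)`. -/
def dividedDiffLongest {K : Type*} [Field K] {n : ℕ} (F : RatFun K n) : RatFun K n :=
  (∑ σ : Equiv.Perm (Fin n), ((Equiv.Perm.sign σ : ℤ) : RatFun K n) * permAct K σ F) /
    ∏ i : Fin n, ∏ j ∈ Ioi i, (ratX K i - ratX K j)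

/-- The linear form `q xᵢ - xⱼ`, as a rational function. -/
def qForm {K : Type*} [Field K] (q : K) {n : ℕ} (i j : Fin n) : RatFun K n :=
  algebraMap (MvPolynomial (Fin n) K) (RatFun K n) (C q * X i - X j)

/-- The operator `□_{w₀} = ∂_{w₀} ∘ ∏_{i<j} (q xᵢ - xⱼ)` (first multiply, then apply
`∂_{w₀}`) on rational functions. -/
def squareLongest {K : Type*} [Field K] (q : K) {n : ℕ} (F : RatFun K n) : RatFun K n :=
  dividedDiffLongest ((∏ i : Fin n, ∏ j ∈ Ioi i, qForm q i j) * F)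

/-- The `q`-divided symmetrization `⟨f⟩_n^q = □_{w₀} (f / ∏_{1 ≤ i ≤ n-1} (q xᵢ - xᵢ₊₁))` of a
polynomial `f` in `n` variables. -/
def qds {K : Type*} [Field K] (q : K) {n : ℕ} (f : MvPolynomial (Fin n) K) : RatFun K n :=
  squareLongest q
    (algebraMap (MvPolynomial (Fin n) K) (RatFun K n) f /
      ∏ i : Fin (n - 1), qForm q (⟨i, by omega⟩ : Fin n) ⟨i + 1, by omega⟩)

/-- A polynomial in `x₁, …, xₙ` is quasisymmetric if for all positive `α₁, …, α_k` the
coefficient of `x_{i₁}^{α₁} ⋯ x_{i_k}^{α_k}`, where `i₁ < ⋯ < i_k`, equals that of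
`x₁^{α₁} ⋯ x_k^{α_k}`. -/
def IsQuasisymmetric {K : Type*} [Field K] {n : ℕ} (p : MvPolynomial (Fin n) K) : Prop :=
  ∀ (k : ℕ) (hk : k ≤ n) (α : Fin k → ℕ), (∀ j, 0 < α j) →
    ∀ i : Fin k → Fin n, StrictMono i →
      coeff (∑ j, Finsupp.single (i j) (α j)) p =
        coeff (∑ j, Finsupp.single (Fin.castLE hk j) (α j)) p

/-- The ideal `QSym_n^+` of `K[x₁, …, xₙ]` generated by the quasisymmetric polynomials without
constant term. -/
def qsymPlus (K : Type*) [Field K] (n : ℕ) : Ideal (MvPolynomial (Fin n) K) :=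
  Ideal.span {p | IsQuasisymmetric p ∧ constantCoeff p = 0}

/-- The exponent vectors of the Aval–Bergeron–Bergeron monomials:
`c_i + ⋯ + c_n ≤ n - i` for `1 ≤ i ≤ n` (here `i` is counted from `0`). -/
def abbSet (n : ℕ) : Set (Fin n →₀ ℕ) :=
  {c | ∀ i : Fin n, ∑ j ∈ Ici i, c j ≤ n - (i + 1)}

/-- The span `L_n` of the Aval–Bergeron–Bergeron monomials. -/
def abbSpan (K : Type*) [Field K] (n : ℕ) : Submodule K (MvPolynomial (Fin n) K) :=
  Submodule.span K ((fun c => monomial c (1 : K)) '' abbSet n)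

/-- The lattice word `N^{d₀} E N^{d₁} E ⋯ N^{d_{m-1}} E`, where a north step is written `U` and
an east step is written `D`. -/
def stepWord (d : ℕ → ℕ) (m : ℕ) : List DyckStep :=
  (List.range m).flatMap fun i => List.replicate (d i) DyckStep.U ++ [DyckStep.D]

theorem stepWord_succ (d : ℕ → ℕ) (m : ℕ) :
    stepWord d (m + 1) =
      stepWord d m ++ (List.replicate (d m) DyckStep.U ++ [DyckStep.D]) := by
  simp [stepWord, List.range_succ]

theorem stepWord_count_D (d : ℕ → ℕ) (m : ℕ) : (stepWord d m).count DyckStep.D = m := by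
  induction m with
  | zero => simp [stepWord]
  | succ m ih => simp [stepWord_succ, ih, List.count_replicate]

theorem stepWord_count_U (d : ℕ → ℕ) (m : ℕ) :
    (stepWord d m).count DyckStep.U = ∑ i ∈ range m, d i := by
  induction m with
  | zero => simp [stepWord]
  | succ m ih => simp [stepWord_succ, ih, Finset.sum_range_succ]

theorem stepWord_prefix (d : ℕ → ℕ) (m : ℕ) (hd : ∀ j ≤ m, j ≤ ∑ i ∈ range j, d i) (p : ℕ) :
    ((stepWord d m).take p).count DyckStep.D ≤ ((stepWord d m).take p).count DyckStep.U := by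
  induction m generalizing p with
  | zero => simp [stepWord]
  | succ m ih =>
    have ih' := ih (fun j hj => hd j (by omega))
    rcases le_or_gt p (stepWord d m).length with hp | hp
    · rw [stepWord_succ, List.take_append_of_le_length hp]
      exact ih' p
    · rw [stepWord_succ, List.take_append, List.take_of_length_le hp.le, List.count_append,
        List.count_append, stepWord_count_D, stepWord_count_U]
      have h1 := hd m (by omega)
      have h2 := hd (m + 1) le_rfl
      rw [Finset.sum_range_succ] at h2
      generalize p - (stepWord d m).length = t
      rcases le_or_gt t (d m) with ht | ht
      · rw [List.take_append_of_le_length (by simpa using ht)]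
        simp [List.take_replicate, List.count_replicate]
        omega
      · rw [List.take_of_length_le (by simp; omega)]
        simp [List.count_replicate]
        omega

/-- A vector `(c₁, …, cₙ)` extended by zeros, indexed from `0`. -/
def extendZero {n : ℕ} (c : Fin n →₀ ℕ) (i : ℕ) : ℕ :=
  if h : i < n then c ⟨i, h⟩ else 0

theorem sum_extendZero_add {n : ℕ} (c : Fin n →₀ ℕ) (i : Fin n) :
    ∑ j ∈ range i, extendZero c j + ∑ j ∈ Ici i, c j = ∑ j, c j := by
  have h1 : ∑ j, c j = ∑ j ∈ range n, extendZero c j := by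
    rw [Finset.sum_range]
    exact Finset.sum_congr rfl fun j _ => by simp [extendZero]
  have h2 : ∑ j ∈ Ici i, c j = ∑ j ∈ Ico (i : ℕ) n, extendZero c j := by
    refine Finset.sum_bij (fun j _ => (j : ℕ)) ?_ ?_ ?_ ?_
    · intro j hj
      simp only [Finset.mem_Ici, Fin.le_def] at hj
      simp [hj]
    · intro a _ b _ h
      exact Fin.ext h
    · intro b hb
      simp only [Finset.mem_Ico] at hb
      exact ⟨⟨b, hb.2⟩, by simpa [Fin.le_def] using hb.1, rfl⟩
    · intro j _
      simp [extendZero]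
  rw [h1, h2, Finset.sum_range_add_sum_Ico _ i.2.le]

theorem abbSet_prefix {n : ℕ} {c : Fin n →₀ ℕ} (hc : c ∈ abbSet n)
    (hdeg : ∑ i, c i = n - 1) {j : ℕ} (hj : j ≤ n - 1) :
    j ≤ ∑ i ∈ range j, extendZero c i := by
  rcases Nat.eq_zero_or_pos n with rfl | hn
  · omega
  · have h1 := sum_extendZero_add c ⟨j, by omega⟩
    have h2 := hc ⟨j, by omega⟩
    simp only at h1 h2
    omega

theorem abbSet_total {n : ℕ} {c : Fin n →₀ ℕ} (hc : c ∈ abbSet n)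
    (hdeg : ∑ i, c i = n - 1) : ∑ i ∈ range (n - 1), extendZero c i = n - 1 := by
  rcases Nat.eq_zero_or_pos n with rfl | hn
  · simp
  · have h1 := sum_extendZero_add c ⟨n - 1, by omega⟩
    have h2 := hc ⟨n - 1, by omega⟩
    simp only at h1 h2
    omega

/-- The Dyck path `N^{c₁} E N^{c₂} E ⋯ N^{c_{n-1}} E` from `(0,0)` to `(n-1,n-1)`, weakly above
the diagonal, attached to the exponent vector `c` of an Aval–Bergeron–Bergeron monomial of degree
`n - 1` (for which `cₙ = 0`). North steps are `U`, east steps are `D`. -/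
def abbDyck {n : ℕ} (c : Fin n →₀ ℕ) (hc : c ∈ abbSet n) (hdeg : ∑ i, c i = n - 1) :
    DyckWord where
  toList := stepWord (extendZero c) (n - 1)
  count_U_eq_count_D := by
    rw [stepWord_count_D, stepWord_count_U, abbSet_total hc hdeg]
  count_D_le_count_U p :=
    stepWord_prefix _ _ (fun _ hj => abbSet_prefix hc hdeg hj) p

/-- The complementary area of a Dyck path `w` from `(0,0)` to `(m,m)`: the number of those of the
`m(m-1)/2` unit cells `[a,a+1] × [b,b+1]`, `0 ≤ a < b < m`, above the diagonal that do not lie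
between the path and the diagonal. These are the cells above the path, that is, the path visits
a lattice point weakly to the south-east of the corner `(a+1,b)`. -/
def coarea (w : DyckWord) : ℕ :=
  #{x ∈ range w.semilength ×ˢ range w.semilength | x.1 < x.2 ∧
    ∃ p ∈ range (w.toList.length + 1),
      x.1 + 1 ≤ (w.toList.take p).count DyckStep.D ∧
        (w.toList.take p).count DyckStep.U ≤ x.2}

end

/-!
Let `Tₖ f = (f(…, xₖ, 0, …) - f(…, 0, xₖ, …)) / xₖ` and let `Λ` be the functional on polynomials of
degree `n` in `n + 1` variables obtained by iterating `∑ₖ qᵏ Tₖ` down to a constant. Inserting a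
zero into a quasisymmetric polynomial gives the same polynomial at every position, so `Tₖ` is
linear over quasisymmetric polynomials and `Λ` vanishes on `QSym⁺`. On the span of the
Aval–Bergeron–Bergeron monomials the sum `∑ₖ xₖ Tₖ f` telescopes to `f(x₀, …, x_{n-1}, 0)`, so `Λ`
is evaluation at `(1, q, …, qⁿ)`.

It remains to see that `Λ` is the divided symmetrization. With `G = ∏_{i+1<j} (q xᵢ - xⱼ)`, the
antisymmetrization of `f G` is a constant times the Vandermonde product, for degree reasons.
Setting a variable to zero in both turns `f` into `∑ₖ qᵏ Tₖ f`, so this constant satisfies the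
recursion defining `Λ`.
-/

section Trimming

variable {R : Type*} [CommRing R] {n : ℕ}

/-- The Bergeron–Sottile map `f ↦ f(x₀, …, x_{p-1}, 0, x_p, …, x_{n-1})`. -/
noncomputable def bergeronSottile (p : Fin (n + 1)) :
    MvPolynomial (Fin (n + 1)) R →ₐ[R] MvPolynomial (Fin n) R :=
  killCompl (Fin.succAbove_right_injective (p := p))

theorem coeff_bergeronSottile (p : Fin (n + 1)) (f : MvPolynomial (Fin (n + 1)) R)
    (m : Fin n →₀ ℕ) : coeff m (bergeronSottile p f) = coeff (m.mapDomain p.succAbove) f :=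
  coeff_killCompl _

theorem bergeronSottile_C (p : Fin (n + 1)) (a : R) : bergeronSottile p (C a) = C a :=
  killCompl_C _ a

@[simp]
theorem bergeronSottile_X_self (p : Fin (n + 1)) :
    bergeronSottile p (X p : MvPolynomial (Fin (n + 1)) R) = 0 := by
  simp [bergeronSottile, killCompl]

@[simp]
theorem bergeronSottile_X_succAbove (p : Fin (n + 1)) (j : Fin n) :
    bergeronSottile p (X (p.succAbove j) : MvPolynomial (Fin (n + 1)) R) = X j := by
  rw [← rename_X p.succAbove j, bergeronSottile, killCompl_rename_app]

theorem mapDomain_succAbove_succ_eq_castSucc (k : Fin n) {m : Fin n →₀ ℕ} (hm : m k = 0) :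
    m.mapDomain k.succ.succAbove = m.mapDomain k.castSucc.succAbove := by
  refine Finsupp.mapDomain_congr fun j hj => ?_
  have hjk : j ≠ k := by
    rintro rfl
    exact Finsupp.mem_support_iff.mp hj hm
  rcases hjk.lt_or_gt with h | h
  · rw [Fin.succAbove_succ_of_le _ _ h.le, Fin.succAbove_castSucc_of_lt _ _ h]
  · rw [Fin.succAbove_succ_of_lt _ _ h, Fin.succAbove_castSucc_of_le _ _ h.le]

/-- The trimming operator, or quasisymmetric divided difference,
`f ↦ (f(…, x_k, 0, …) - f(…, 0, x_k, …)) / x_k`. -/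
noncomputable def trim (k : Fin n) :
    MvPolynomial (Fin (n + 1)) R →ₗ[R] MvPolynomial (Fin n) R where
  toFun f := (bergeronSottile k.succ f - bergeronSottile k.castSucc f).divMonomial
    (Finsupp.single k 1)
  map_add' f g := by
    rw [← add_divMonomial, map_add, map_add, add_sub_add_comm]
  map_smul' a f := by
    ext m
    simp [coeff_divMonomial, mul_sub]

theorem coeff_trim (k : Fin n) (f : MvPolynomial (Fin (n + 1)) R) (m : Fin n →₀ ℕ) :
    coeff m (trim k f) =
      coeff ((Finsupp.single k 1 + m).mapDomain k.succ.succAbove) f -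
        coeff ((Finsupp.single k 1 + m).mapDomain k.castSucc.succAbove) f := by
  simp only [trim, LinearMap.coe_mk, AddHom.coe_mk, coeff_divMonomial, coeff_sub,
    coeff_bergeronSottile]

theorem exists_coeff_ne_zero_of_coeff_trim_ne_zero {k : Fin n}
    {f : MvPolynomial (Fin (n + 1)) R} {m : Fin n →₀ ℕ} (h : coeff m (trim k f) ≠ 0) :
    ∃ p : Fin (n + 1), (p = k.castSucc ∨ p = k.succ) ∧
      coeff ((Finsupp.single k 1 + m).mapDomain p.succAbove) f ≠ 0 := by
  contrapose! h
  rw [coeff_trim, h _ (.inl rfl), h _ (.inr rfl), sub_zero]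

theorem X_mul_trim (k : Fin n) (f : MvPolynomial (Fin (n + 1)) R) :
    X k * trim k f = bergeronSottile k.succ f - bergeronSottile k.castSucc f := by
  ext m
  rw [coeff_X_mul', coeff_sub, coeff_bergeronSottile, coeff_bergeronSottile]
  split_ifs with hk
  · have hm : Finsupp.single k 1 + (m - Finsupp.single k 1) = m :=
      add_tsub_cancel_of_le (Finsupp.single_le_iff.mpr
        (Nat.one_le_iff_ne_zero.mpr (Finsupp.mem_support_iff.mp hk)))
    rw [coeff_trim, hm]
  · rw [mapDomain_succAbove_succ_eq_castSucc k (Finsupp.notMem_support_iff.mp hk), sub_self]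

theorem sum_X_mul_trim (f : MvPolynomial (Fin (n + 1)) R) :
    ∑ k, X k * trim k f = bergeronSottile (Fin.last n) f - bergeronSottile 0 f := by
  have htelescope := (Fin.sum_univ_castSucc fun p => bergeronSottile p f).symm.trans
    (Fin.sum_univ_succ fun p => bergeronSottile p f)
  simp only [X_mul_trim, sum_sub_distrib]
  linear_combination -htelescope

theorem isHomogeneous_trim (k : Fin n) {f : MvPolynomial (Fin (n + 1)) R} {d : ℕ}
    (hf : f.IsHomogeneous (d + 1)) : (trim k f).IsHomogeneous d := by
  intro m hm
  obtain ⟨p, -, hp⟩ := exists_coeff_ne_zero_of_coeff_trim_ne_zero hm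
  have hdeg : (Finsupp.single k 1 + m).degree = d + 1 := by
    rw [← Finsupp.degree_mapDomain p.succAbove, Finsupp.degree_eq_weight_one]
    exact hf hp
  rw [map_add, Finsupp.degree_single] at hdeg
  change Finsupp.weight (fun _ => 1) m = d
  rw [← Finsupp.degree_eq_weight_one]
  omega

/-- The combination `∑ₖ qᵏ Tₖ` of the trimming operators. -/
noncomputable def qTrim (q : R) :
    MvPolynomial (Fin (n + 1)) R →ₗ[R] MvPolynomial (Fin n) R :=
  ∑ k : Fin n, q ^ (k : ℕ) • trim k

theorem qTrim_apply (q : R) (f : MvPolynomial (Fin (n + 1)) R) :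
    qTrim q f = ∑ k : Fin n, q ^ (k : ℕ) • trim k f := by
  simp only [qTrim, LinearMap.sum_apply, LinearMap.smul_apply]

theorem isHomogeneous_qTrim (q : R) {f : MvPolynomial (Fin (n + 1)) R} {d : ℕ}
    (hf : f.IsHomogeneous (d + 1)) : (qTrim q f).IsHomogeneous d := by
  rw [qTrim_apply]
  refine IsHomogeneous.sum _ _ _ fun k _ => ?_
  rw [smul_eq_C_mul]
  exact (isHomogeneous_trim k hf).C_mul _

/-- The functional sending a polynomial of degree `n` in `n + 1` variables to the constant
obtained by trimming it `n` times with `qTrim q`. -/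
noncomputable def trimFunctional (q : R) :
    (n : ℕ) → MvPolynomial (Fin (n + 1)) R →ₗ[R] R
  | 0 => lcoeff R 0
  | n + 1 => trimFunctional q n ∘ₗ qTrim q

theorem trimFunctional_succ (q : R) (f : MvPolynomial (Fin (n + 2)) R) :
    trimFunctional q (n + 1) f = trimFunctional q n (qTrim q f) :=
  rfl

end Trimming

section Quasisymmetric

variable {K : Type*} [Field K] {n N : ℕ}

theorem exists_strictMono_sum_single_eq (m : Fin n →₀ ℕ) :
    ∃ (k : ℕ) (i : Fin k → Fin n) (α : Fin k → ℕ), StrictMono i ∧ (∀ j, 0 < α j) ∧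
      ∑ j, Finsupp.single (i j) (α j) = m := by
  let i := m.support.orderEmbOfFin rfl
  refine ⟨#m.support, i, fun j => m (i j), i.strictMono, fun j => ?_, ?_⟩
  · exact Nat.pos_of_ne_zero (Finsupp.mem_support_iff.mp (m.support.orderEmbOfFin_mem rfl j))
  · have h := Finset.sum_map univ i.toEmbedding fun x => Finsupp.single x (m x)
    rw [Finset.map_orderEmbOfFin_univ] at h
    exact h.symm.trans (Finsupp.sum_single m)

theorem IsQuasisymmetric.coeff_mapDomain_eq {Q : MvPolynomial (Fin N) K}
    (hQ : IsQuasisymmetric Q) {e₁ e₂ : Fin n → Fin N} (he₁ : StrictMono e₁) (he₂ : StrictMono e₂)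
    (m : Fin n →₀ ℕ) : coeff (m.mapDomain e₁) Q = coeff (m.mapDomain e₂) Q := by
  obtain ⟨k, i, α, hi, hα, rfl⟩ := exists_strictMono_sum_single_eq m
  have hk : k ≤ N := by simpa using Fintype.card_le_of_injective _ (he₁.comp hi).injective
  simp only [Finsupp.mapDomain_finsetSum, Finsupp.mapDomain_single]
  exact (hQ k hk α hα _ (he₁.comp hi)).trans (hQ k hk α hα _ (he₂.comp hi)).symm

theorem IsQuasisymmetric.bergeronSottile_eq {Q : MvPolynomial (Fin (n + 1)) K}
    (hQ : IsQuasisymmetric Q) (p p' : Fin (n + 1)) :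
    bergeronSottile p Q = bergeronSottile p' Q := by
  ext m
  rw [coeff_bergeronSottile, coeff_bergeronSottile]
  exact hQ.coeff_mapDomain_eq (Fin.strictMono_succAbove _) (Fin.strictMono_succAbove _) m

theorem isQuasisymmetric_bergeronSottile {Q : MvPolynomial (Fin (n + 1)) K}
    (hQ : IsQuasisymmetric Q) (p : Fin (n + 1)) : IsQuasisymmetric (bergeronSottile p Q) := by
  intro k hk α _ i hi
  have h := hQ.coeff_mapDomain_eq ((Fin.strictMono_succAbove p).comp hi)
    ((Fin.strictMono_succAbove p).comp (Fin.strictMono_castLE hk))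
    (∑ j, Finsupp.single j (α j))
  simpa only [coeff_bergeronSottile, Finsupp.mapDomain_finsetSum, Finsupp.mapDomain_single,
    Function.comp_apply] using h

theorem IsQuasisymmetric.trim_mul {Q : MvPolynomial (Fin (n + 1)) K} (hQ : IsQuasisymmetric Q)
    (k : Fin n) (f : MvPolynomial (Fin (n + 1)) K) :
    trim k (f * Q) = trim k f * bergeronSottile 0 Q := by
  apply mul_left_cancel₀ (X_ne_zero (R := K) k)
  rw [← mul_assoc, X_mul_trim, X_mul_trim, map_mul, map_mul, hQ.bergeronSottile_eq k.castSucc 0,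
    hQ.bergeronSottile_eq k.succ 0, sub_mul]

theorem IsQuasisymmetric.qTrim_mul {Q : MvPolynomial (Fin (n + 1)) K} (hQ : IsQuasisymmetric Q)
    (q : K) (f : MvPolynomial (Fin (n + 1)) K) :
    qTrim q (f * Q) = qTrim q f * bergeronSottile 0 Q := by
  simp only [qTrim_apply, hQ.trim_mul, ← smul_mul_assoc, ← sum_mul]

theorem IsQuasisymmetric.trimFunctional_mul_eq_zero (q : K) {Q : MvPolynomial (Fin (n + 1)) K}
    (hQ : IsQuasisymmetric Q) (hQ₀ : constantCoeff Q = 0) (f : MvPolynomial (Fin (n + 1)) K) :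
    trimFunctional q n (f * Q) = 0 := by
  induction n with
  | zero =>
    change constantCoeff (f * Q) = 0
    rw [map_mul, hQ₀, mul_zero]
  | succ n ih =>
    rw [trimFunctional_succ, hQ.qTrim_mul]
    refine ih (isQuasisymmetric_bergeronSottile hQ 0) ?_ _
    rwa [constantCoeff_eq, coeff_bergeronSottile, Finsupp.mapDomain_zero, ← constantCoeff_eq]

theorem trimFunctional_eq_zero_of_mem_qsymPlus (q : K) {h : MvPolynomial (Fin (n + 1)) K}
    (hh : h ∈ qsymPlus K (n + 1)) : trimFunctional q n h = 0 := by
  induction hh using Submodule.closure_induction with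
  | zero => exact map_zero _
  | add x y _ _ hx hy => rw [map_add, hx, hy, add_zero]
  | smul_mem f Q hQ => exact hQ.1.trimFunctional_mul_eq_zero q hQ.2 f

end Quasisymmetric

section AvalBergeronBergeron

variable {K : Type*} [Field K] {n : ℕ}

theorem mem_abbSpan_iff {f : MvPolynomial (Fin n) K} :
    f ∈ abbSpan K n ↔ ∀ c, coeff c f ≠ 0 → c ∈ abbSet n := by
  rw [abbSpan, ← restrictSupport_eq_span, mem_restrictSupport_iff]
  simp only [Set.subset_def, Finset.mem_coe, mem_support_iff]

theorem apply_last_eq_zero_of_mem_abbSet {c : Fin (n + 1) →₀ ℕ} (hc : c ∈ abbSet (n + 1)) :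
    c (Fin.last n) = 0 := by
  have htail := hc (Fin.last n)
  have hle : c (Fin.last n) ≤ ∑ j ∈ Ici (Fin.last n), c j :=
    single_le_sum_of_canonicallyOrdered (mem_Ici.mpr le_rfl)
  rw [Fin.val_last, Nat.sub_self] at htail
  omega

theorem degree_le_of_mem_abbSet {c : Fin (n + 1) →₀ ℕ} (hc : c ∈ abbSet (n + 1)) :
    c.degree ≤ n := by
  have htail := hc 0
  rwa [← bot_eq_zero, Ici_bot, ← Finsupp.degree_eq_sum] at htail

theorem apply_zero_ne_zero_of_mem_abbSet {c : Fin (n + 2) →₀ ℕ} (hc : c ∈ abbSet (n + 2))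
    (hdeg : c.degree = n + 1) : c 0 ≠ 0 := by
  have htail := hc (Fin.succ 0)
  rw [← Fin.map_succEmb_Ici, sum_map, ← bot_eq_zero, Ici_bot, Fin.val_succ] at htail
  rw [Finsupp.degree_eq_sum, Fin.sum_univ_succ] at hdeg
  simp only [Fin.coe_succEmb] at htail
  omega

theorem sum_Ici_le_sum_Ici_mapDomain_succAbove (p : Fin (n + 1)) (m : Fin n →₀ ℕ) (i : Fin n) :
    ∑ j ∈ Ici i, m j ≤ ∑ j ∈ Ici (p.succAbove i), m.mapDomain p.succAbove j := by
  calc ∑ j ∈ Ici i, m j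
      = ∑ j ∈ (Ici i).map p.succAboveEmb, m.mapDomain p.succAbove j := by
        simp only [sum_map, Fin.coe_succAboveEmb,
          Finsupp.mapDomain_apply Fin.succAbove_right_injective]
    _ ≤ _ := sum_le_sum_of_subset fun x hx => by
        obtain ⟨j, hj, rfl⟩ := mem_map.mp hx
        exact mem_Ici.mpr ((Fin.strictMono_succAbove p).monotone (mem_Ici.mp hj))

theorem mem_abbSet_of_mapDomain_succAbove {k : Fin (n + 1)} {p : Fin (n + 2)}
    (hp : p = k.castSucc ∨ p = k.succ) {m : Fin (n + 1) →₀ ℕ}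
    (hc : (Finsupp.single k 1 + m).mapDomain p.succAbove ∈ abbSet (n + 2)) :
    m ∈ abbSet (n + 1) := by
  intro i
  have htail := (sum_Ici_le_sum_Ici_mapDomain_succAbove p _ i).trans (hc (p.succAbove i))
  have hsplit : ∑ j ∈ Ici i, (Finsupp.single k 1 + m : Fin (n + 1) →₀ ℕ) j =
      (if i ≤ k then 1 else 0) + ∑ j ∈ Ici i, m j := by
    simp [sum_add_distrib, Finsupp.single_apply]
  rw [hsplit] at htail
  split_ifs at htail with hik
  · have hle : (i : ℕ) ≤ p.succAbove i := by
      rw [Fin.succAbove]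
      split_ifs <;> simp
    omega
  · have hpi : p ≤ i.castSucc := by
      rcases hp with rfl | rfl
      · exact Fin.castSucc_le_castSucc_iff.mpr (not_le.mp hik).le
      · exact Fin.succ_le_castSucc_iff.mpr (not_le.mp hik)
    rw [Fin.succAbove_of_le_castSucc _ _ hpi, Fin.val_succ] at htail
    omega

theorem qTrim_mem_abbSpan (q : K) {f : MvPolynomial (Fin (n + 2)) K}
    (hf : f ∈ abbSpan K (n + 2)) : qTrim q f ∈ abbSpan K (n + 1) := by
  rw [qTrim_apply]
  refine Submodule.sum_smul_mem _ _ fun k _ => mem_abbSpan_iff.mpr fun m hm => ?_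
  obtain ⟨p, hp, hcoeff⟩ := exists_coeff_ne_zero_of_coeff_trim_ne_zero hm
  exact mem_abbSet_of_mapDomain_succAbove hp (mem_abbSpan_iff.mp hf _ hcoeff)

theorem bergeronSottile_zero_eq_zero {f : MvPolynomial (Fin (n + 2)) K}
    (hf : f ∈ abbSpan K (n + 2)) (hdeg : f.IsHomogeneous (n + 1)) : bergeronSottile 0 f = 0 := by
  ext m
  rw [coeff_bergeronSottile, coeff_zero]
  by_contra hm
  refine apply_zero_ne_zero_of_mem_abbSet (mem_abbSpan_iff.mp hf _ hm) ?_
    (Finsupp.mapDomain_of_notMem_range _ _ (by simp))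
  rw [Finsupp.degree_eq_weight_one]
  exact hdeg hm

theorem eval_bergeronSottile_last {f : MvPolynomial (Fin (n + 1)) K} (hf : f ∈ abbSpan K (n + 1))
    (y : Fin (n + 1) → K) :
    eval (y ∘ Fin.castSucc) (bergeronSottile (Fin.last n) f) = eval y f := by
  refine hom_congr_vars
    (f₁ := (eval (y ∘ Fin.castSucc)).comp (bergeronSottile (Fin.last n)).toRingHom)
    (f₂ := eval y) (by ext; simp) (fun i hi _ => ?_) rfl
  obtain ⟨c, hc, hic⟩ := (mem_vars_iff_mem_support i).mp hi
  induction i using Fin.lastCases with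
  | last =>
    exact absurd (apply_last_eq_zero_of_mem_abbSet
      (mem_abbSpan_iff.mp hf c (mem_support_iff.mp hc))) (Finsupp.mem_support_iff.mp hic)
  | cast j =>
    have hbs := bergeronSottile_X_succAbove (R := K) (Fin.last n) j
    rw [Fin.succAbove_last_apply] at hbs
    simp [hbs]

theorem eval_qTrim {q : K} {f : MvPolynomial (Fin (n + 2)) K} (hf : f ∈ abbSpan K (n + 2))
    (hdeg : f.IsHomogeneous (n + 1)) :
    eval (fun i : Fin (n + 1) => q ^ (i : ℕ)) (qTrim q f) =
      eval (fun i : Fin (n + 2) => q ^ (i : ℕ)) f := by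
  calc eval (fun i : Fin (n + 1) => q ^ (i : ℕ)) (qTrim q f)
      = eval (fun i : Fin (n + 1) => q ^ (i : ℕ)) (∑ k, X k * trim k f) := by
        simp only [qTrim_apply, map_sum, smul_eval, map_mul, eval_X]
    _ = eval (fun i : Fin (n + 1) => q ^ (i : ℕ)) (bergeronSottile (Fin.last (n + 1)) f) := by
        rw [sum_X_mul_trim, bergeronSottile_zero_eq_zero hf hdeg, sub_zero]
    _ = _ := eval_bergeronSottile_last hf fun i => q ^ (i : ℕ)

theorem trimFunctional_eq_eval (q : K) {f : MvPolynomial (Fin (n + 1)) K}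
    (hf : f ∈ abbSpan K (n + 1)) (hdeg : f.IsHomogeneous n) :
    trimFunctional q n f = eval (fun i : Fin (n + 1) => q ^ (i : ℕ)) f := by
  induction n with
  | zero =>
    rw [totalDegree_eq_zero_iff_eq_C.mp ((totalDegree_zero_iff_isHomogeneous _).mpr hdeg), eval_C]
    simp [trimFunctional]
  | succ n ih =>
    rw [trimFunctional_succ, ih (qTrim_mem_abbSpan q hf) (isHomogeneous_qTrim q hdeg),
      eval_qTrim hf hdeg]

end AvalBergeronBergeron

section Padding

/-- Homogenization to degree `d` with respect to the first variable: each component of degree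
`e ≤ d` is multiplied by `x₀ ^ (d - e)`; components of degree above `d` are discarded.
It reduces a decomposition `f = g + h` of a homogeneous `f` to one with `g` and `h` homogeneous,
without changing the value of `g` at points with `x₀ = 1`. -/
noncomputable def padToDegree {R : Type*} [CommRing R] {n : ℕ} (d : ℕ) :
    MvPolynomial (Fin (n + 1)) R →ₗ[R] MvPolynomial (Fin (n + 1)) R :=
  ∑ e ∈ range (d + 1), LinearMap.mulLeft R (X 0 ^ (d - e)) ∘ₗ homogeneousComponent e

variable {R : Type*} [CommRing R] {n d : ℕ}

theorem padToDegree_apply (f : MvPolynomial (Fin (n + 1)) R) :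
    padToDegree d f = ∑ e ∈ range (d + 1), X 0 ^ (d - e) * homogeneousComponent e f := by
  simp only [padToDegree, LinearMap.sum_apply, LinearMap.comp_apply, LinearMap.mulLeft_apply]

theorem isHomogeneous_padToDegree (f : MvPolynomial (Fin (n + 1)) R) :
    (padToDegree d f).IsHomogeneous d := by
  rw [padToDegree_apply]
  refine IsHomogeneous.sum _ _ _ fun e he => ?_
  have hed : d - e + e = d := Nat.sub_add_cancel (Nat.lt_succ_iff.mp (mem_range.mp he))
  simpa only [hed] using
    (isHomogeneous_X_pow 0 (d - e)).mul (homogeneousComponent_isHomogeneous e f)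

theorem padToDegree_of_isHomogeneous {f : MvPolynomial (Fin (n + 1)) R} (hf : f.IsHomogeneous d) :
    padToDegree d f = f := by
  rw [padToDegree_apply, sum_eq_single d]
  · rw [homogeneousComponent_of_mem hf, if_pos rfl, Nat.sub_self, pow_zero, one_mul]
  · intro e _ hed
    rw [homogeneousComponent_of_mem hf, if_neg hed, mul_zero]
  · simp

theorem eval_padToDegree {f : MvPolynomial (Fin (n + 1)) R} (hf : f.totalDegree ≤ d)
    {y : Fin (n + 1) → R} (hy : y 0 = 1) : eval y (padToDegree d f) = eval y f := by
  have hcomponents : ∑ e ∈ range (d + 1), homogeneousComponent e f = f := by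
    rw [← sum_subset (range_subset_range.mpr (Nat.succ_le_succ hf)) fun e _ he => ?_,
      sum_homogeneousComponent]
    exact homogeneousComponent_eq_zero _ _ (by simpa using he)
  conv_rhs => rw [← hcomponents]
  simp only [padToDegree_apply, map_sum, map_mul, map_pow, eval_X, hy, one_pow, one_mul]

variable {K : Type*} [Field K]

theorem single_zero_add_mem_abbSet {c : Fin (n + 1) →₀ ℕ} (hc : c ∈ abbSet (n + 1)) {r : ℕ}
    (hr : r + c.degree ≤ n) : Finsupp.single 0 r + c ∈ abbSet (n + 1) := by
  intro i
  rcases eq_or_ne i 0 with rfl | hi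
  · rwa [← bot_eq_zero, Ici_bot, ← Finsupp.degree_eq_sum, map_add, Finsupp.degree_single]
  · refine le_of_eq_of_le (sum_congr rfl fun j hj => ?_) (hc i)
    have hj0 : j ≠ 0 := (lt_of_lt_of_le (Fin.pos_iff_ne_zero.mpr hi) (mem_Ici.mp hj)).ne'
    rw [Finsupp.add_apply, Finsupp.single_eq_of_ne hj0, zero_add]

theorem padToDegree_mem_abbSpan {g : MvPolynomial (Fin (n + 1)) K} (hg : g ∈ abbSpan K (n + 1)) :
    padToDegree n g ∈ abbSpan K (n + 1) := by
  rw [padToDegree_apply]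
  refine Submodule.sum_mem _ fun e he => mem_abbSpan_iff.mpr fun c hc => ?_
  rw [X_pow_eq_monomial, coeff_monomial_mul', one_mul, coeff_homogeneousComponent] at hc
  split_ifs at hc with hle hdeg
  · rw [← add_tsub_cancel_of_le hle]
    refine single_zero_add_mem_abbSet (mem_abbSpan_iff.mp hg _ hc) ?_
    rw [hdeg, Nat.sub_add_cancel (Nat.lt_succ_iff.mp (mem_range.mp he))]
  all_goals exact absurd rfl hc

theorem isQuasisymmetric_homogeneousComponent {Q : MvPolynomial (Fin n) K}
    (hQ : IsQuasisymmetric Q) (e : ℕ) : IsQuasisymmetric (homogeneousComponent e Q) := by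
  intro k hk α hα i hi
  simp only [coeff_homogeneousComponent, map_sum, Finsupp.degree_single, hQ k hk α hα i hi]

theorem qsymPlus_eq_span_homogeneous :
    qsymPlus K n = Ideal.span {p | (IsQuasisymmetric p ∧ constantCoeff p = 0) ∧
      SetLike.IsHomogeneousElem (homogeneousSubmodule (Fin n) K) p} := by
  refine le_antisymm (Ideal.span_le.mpr fun p hp => ?_) (Ideal.span_mono fun p hp => hp.1)
  rw [SetLike.mem_coe, ← sum_homogeneousComponent p]
  refine Ideal.sum_mem _ fun e _ => Ideal.subset_span
    ⟨⟨isQuasisymmetric_homogeneousComponent hp.1 e, ?_⟩, e, homogeneousComponent_isHomogeneous e p⟩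
  rw [constantCoeff_eq, coeff_homogeneousComponent, ← constantCoeff_eq, hp.2, ite_self]

theorem padToDegree_mem_qsymPlus {h : MvPolynomial (Fin (n + 1)) K}
    (hh : h ∈ qsymPlus K (n + 1)) : padToDegree d h ∈ qsymPlus K (n + 1) := by
  let _ := gradedAlgebra (σ := Fin (n + 1)) (R := K)
  have hhom : (qsymPlus K (n + 1)).IsHomogeneous (homogeneousSubmodule (Fin (n + 1)) K) := by
    rw [qsymPlus_eq_span_homogeneous]
    exact Ideal.homogeneous_span _ _ fun p hp => hp.2
  rw [padToDegree_apply]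
  exact Ideal.sum_mem _ fun e _ =>
    Ideal.mul_mem_left _ _ (homogeneousComponent_mem_of_mem hhom hh e)

theorem trimFunctional_eq_eval_of_eq_add (q : K) {f g h : MvPolynomial (Fin (n + 1)) K}
    (hf : f.IsHomogeneous n) (hg : g ∈ abbSpan K (n + 1)) (hh : h ∈ qsymPlus K (n + 1))
    (hfgh : f = g + h) :
    trimFunctional q n f = eval (fun i : Fin (n + 1) => q ^ (i : ℕ)) g := by
  have hdeg : g.totalDegree ≤ n := Finset.sup_le fun c hc =>
    degree_le_of_mem_abbSet (mem_abbSpan_iff.mp hg c (mem_support_iff.mp hc))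
  calc trimFunctional q n f
      = trimFunctional q n (padToDegree n g) + trimFunctional q n (padToDegree n h) := by
        rw [← map_add, ← map_add, ← hfgh, padToDegree_of_isHomogeneous hf]
    _ = trimFunctional q n (padToDegree n g) := by
        rw [trimFunctional_eq_zero_of_mem_qsymPlus q (padToDegree_mem_qsymPlus hh), add_zero]
    _ = eval (fun i : Fin (n + 1) => q ^ (i : ℕ)) (padToDegree n g) :=
        trimFunctional_eq_eval q (padToDegree_mem_abbSpan hg) (isHomogeneous_padToDegree g)
    _ = eval (fun i : Fin (n + 1) => q ^ (i : ℕ)) g := eval_padToDegree hdeg (pow_zero q)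

end Padding

section Coarea

variable {n : ℕ}

theorem stepWord_isPrefix (d : ℕ → ℕ) {a m : ℕ} (h : a ≤ m) : stepWord d a <+: stepWord d m := by
  induction m, h using Nat.le_induction with
  | base => exact List.prefix_rfl
  | succ m _ ih =>
    rw [stepWord_succ]
    exact ih.trans (List.prefix_append _ _)

theorem count_D_take_stepWord_le (d : ℕ → ℕ) {a m p : ℕ} (h : a < m)
    (hp : p < (stepWord d (a + 1)).length) :
    ((stepWord d m).take p).count DyckStep.D ≤ a := by
  obtain ⟨t, ht⟩ := stepWord_isPrefix d (Nat.succ_le_of_lt h)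
  rw [← ht, List.take_append_of_le_length hp.le, stepWord_succ, ← List.append_assoc]
  rw [stepWord_succ, ← List.append_assoc, List.length_append, List.length_singleton] at hp
  rw [List.take_append_of_le_length (Nat.lt_succ_iff.mp hp)]
  refine ((List.take_sublist _ _).count_le _).trans ?_
  simp [stepWord_count_D, List.count_replicate]

theorem exists_take_stepWord_iff (d : ℕ → ℕ) {a b m : ℕ} (h : a < m) :
    (∃ p ∈ range ((stepWord d m).length + 1),
      a + 1 ≤ ((stepWord d m).take p).count DyckStep.D ∧
        ((stepWord d m).take p).count DyckStep.U ≤ b) ↔ ∑ i ∈ range (a + 1), d i ≤ b := by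
  have hprefix := stepWord_isPrefix d (Nat.succ_le_of_lt h)
  have htake : (stepWord d m).take (stepWord d (a + 1)).length = stepWord d (a + 1) :=
    (List.prefix_iff_eq_take.mp hprefix).symm
  constructor
  · rintro ⟨p, -, hD, hU⟩
    have hp : (stepWord d (a + 1)).length ≤ p := by
      by_contra! hp
      exact absurd hD (Nat.lt_succ_of_le (count_D_take_stepWord_le d h hp)).not_ge
    calc ∑ i ∈ range (a + 1), d i
        = ((stepWord d m).take (stepWord d (a + 1)).length).count DyckStep.U := by
          rw [htake, stepWord_count_U]
      _ ≤ ((stepWord d m).take p).count DyckStep.U :=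
          (List.take_prefix_take_left hp).sublist.count_le _
      _ ≤ b := hU
  · intro hb
    refine ⟨(stepWord d (a + 1)).length, mem_range.mpr (Nat.lt_succ_of_le hprefix.length_le), ?_⟩
    rw [htake, stepWord_count_D, stepWord_count_U]
    exact ⟨le_rfl, hb⟩

theorem card_filter_sum_range_le (d : ℕ → ℕ) {a m : ℕ} (ha : a < m)
    (habove : a + 1 ≤ ∑ i ∈ range (a + 1), d i) (htotal : ∑ i ∈ range m, d i = m) :
    #{b ∈ range m | a < b ∧ ∑ i ∈ range (a + 1), d i ≤ b} = ∑ i ∈ Ico (a + 1) m, d i := by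
  have hfilter : {b ∈ range m | a < b ∧ ∑ i ∈ range (a + 1), d i ≤ b} =
      Ico (∑ i ∈ range (a + 1), d i) m := by
    ext b
    simp only [mem_filter, mem_range, mem_Ico]
    omega
  have hsplit := sum_range_add_sum_Ico d (Nat.succ_le_of_lt ha)
  rw [hfilter, Nat.card_Ico]
  simp only [Nat.succ_eq_add_one] at hsplit
  omega

theorem sum_sum_Ico_succ_eq_sum_mul (d : ℕ → ℕ) (m : ℕ) :
    ∑ a ∈ range m, ∑ i ∈ Ico (a + 1) m, d i = ∑ i ∈ range m, i * d i := by
  rw [sum_comm' (t' := range m) (s' := range)]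
  · simp only [sum_const, card_range, smul_eq_mul]
  · intro a i
    simp only [mem_range, mem_Ico]
    omega

theorem coarea_abbDyck {c : Fin n →₀ ℕ} (hc : c ∈ abbSet n) (hdeg : ∑ i, c i = n - 1) :
    coarea (abbDyck c hc hdeg) = ∑ i ∈ range (n - 1), i * extendZero c i := by
  have htotal := abbSet_total hc hdeg
  have hword : (abbDyck c hc hdeg).toList = stepWord (extendZero c) (n - 1) := rfl
  have hsemilength : (abbDyck c hc hdeg).semilength = n - 1 := by
    rw [DyckWord.semilength, hword, stepWord_count_U, htotal]
  rw [coarea, hsemilength, hword, card_filter, sum_product, ← sum_sum_Ico_succ_eq_sum_mul]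
  refine sum_congr rfl fun a ha => ?_
  have ha' := mem_range.mp ha
  simp only [exists_take_stepWord_iff _ ha']
  rw [← card_filter, card_filter_sum_range_le _ ha' (abbSet_prefix hc hdeg ha') htotal]

theorem eval_monomial_eq_pow_coarea {R : Type*} [CommSemiring R] (q : R) {c : Fin (n + 1) →₀ ℕ}
    (hc : c ∈ abbSet (n + 1)) (hdeg : ∑ i, c i = n) :
    eval (fun i : Fin (n + 1) => q ^ (i : ℕ)) (monomial c 1) =
      q ^ coarea (abbDyck c hc hdeg) := by
  rw [coarea_abbDyck, eval_monomial, one_mul, Finsupp.prod_fintype _ _ fun _ => pow_zero _,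
    Fin.prod_univ_castSucc, apply_last_eq_zero_of_mem_abbSet hc, pow_zero, mul_one,
    Nat.add_sub_cancel, Finset.sum_range, ← prod_pow_eq_pow_sum]
  refine prod_congr rfl fun i _ => ?_
  rw [← pow_mul, extendZero, dif_pos (by omega)]
  rfl

end Coarea

theorem eq_range_of_sum_eq_sum_range {s : Finset ℕ} (h : ∑ x ∈ s, x = ∑ x ∈ range #s, x) :
    s = range #s := by
  set r := range #s with hr
  have hcard : #(s \ r) = #(r \ s) := card_sdiff_comm (by rw [hr, card_range])
  have hsum : ∑ x ∈ s \ r, x = ∑ x ∈ r \ s, x := by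
    have hs := sum_inter_add_sum_sdiff s r id
    have hr' := sum_inter_add_sum_sdiff r s id
    rw [inter_comm] at hr'
    simp only [id_eq] at hs hr'
    omega
  have hlow : #(s \ r) * #s ≤ ∑ x ∈ s \ r, x :=
    card_nsmul_le_sum _ _ _ fun x hx => by simpa [hr] using (mem_sdiff.mp hx).2
  have hhigh : ∑ x ∈ r \ s, (x + 1) ≤ #(r \ s) * #s :=
    sum_le_card_nsmul _ _ _ fun x hx => by
      simpa [hr, Nat.succ_le_iff] using (mem_sdiff.mp hx).1
  have hempty : r \ s = ∅ := by
    rw [sum_add_distrib, sum_const, smul_eq_mul, mul_one] at hhigh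
    rw [← card_eq_zero]
    rw [hcard] at hlow
    omega
  exact (eq_of_subset_of_card_le (sdiff_eq_empty_iff_subset.mp hempty) (by simp [hr])).symm

section Antisymmetrization

variable {R : Type*} [CommRing R] {n : ℕ}

/-- The numerator `∑ sgn(σ) P(x_{σ(0)}, …, x_{σ(n-1)})` of `∂_{w₀} P`. -/
noncomputable def antisymmetrize : MvPolynomial (Fin n) R →ₗ[R] MvPolynomial (Fin n) R :=
  ∑ σ : Equiv.Perm (Fin n),
    LinearMap.mulLeft R ((Equiv.Perm.sign σ : ℤ) : MvPolynomial (Fin n) R) ∘ₗ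
      (rename σ).toLinearMap

theorem antisymmetrize_apply (P : MvPolynomial (Fin n) R) :
    antisymmetrize P =
      ∑ σ : Equiv.Perm (Fin n),
        ((Equiv.Perm.sign σ : ℤ) : MvPolynomial (Fin n) R) * rename σ P := by
  simp [antisymmetrize, LinearMap.sum_apply]

theorem antisymmetrize_mul_of_isSymmetric {S : MvPolynomial (Fin n) R} (hS : S.IsSymmetric)
    (P : MvPolynomial (Fin n) R) : antisymmetrize (S * P) = S * antisymmetrize P := by
  simp only [antisymmetrize_apply, map_mul, hS _, mul_sum, mul_left_comm]

variable (R n) in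
/-- The Vandermonde product `∏_{i<j} (xᵢ - xⱼ)`, the denominator of `∂_{w₀}`. -/
noncomputable def vandermondeProd : MvPolynomial (Fin n) R :=
  ∏ i : Fin n, ∏ j ∈ Ioi i, (X i - X j)

theorem vandermondeProd_ne_zero [IsDomain R] : vandermondeProd R n ≠ 0 :=
  prod_ne_zero_iff.mpr fun _ _ => prod_ne_zero_iff.mpr fun _ hj =>
    sub_ne_zero.mpr fun h => (mem_Ioi.mp hj).ne (X_injective h)

theorem bergeronSottile_zero_vandermondeProd :
    bergeronSottile 0 (vandermondeProd R (n + 1)) =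
      (-1) ^ n * (∏ j, X j) * vandermondeProd R n := by
  have hbs : ∀ j : Fin n, bergeronSottile 0 (X j.succ : MvPolynomial (Fin (n + 1)) R) = X j :=
    fun j => bergeronSottile_X_succAbove 0 j
  have hneg : ∏ j : Fin n, (0 - X j : MvPolynomial (Fin n) R) = (-1) ^ n * ∏ j, X j := by
    simp only [zero_sub, prod_neg, card_univ, Fintype.card_fin]
  simp only [vandermondeProd, Fin.prod_univ_succ, Fin.prod_Ioi_zero, Fin.prod_Ioi_succ, map_mul,
    map_prod, map_sub, bergeronSottile_X_self, hbs, hneg]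

theorem antisymmetrize_monomial (c : Fin n →₀ ℕ) (a : R) :
    antisymmetrize (monomial c a) =
      C a * (Matrix.of fun i j : Fin n => (X i : MvPolynomial (Fin n) R) ^ c j).det := by
  rw [antisymmetrize_apply, Matrix.det_apply', mul_sum]
  refine sum_congr rfl fun σ _ => ?_
  rw [monomial_eq, Finsupp.prod_fintype _ _ fun _ => pow_zero _, map_mul, rename_C, map_prod]
  simp only [map_pow, rename_X, Matrix.of_apply, mul_left_comm]

theorem vandermondeProd_eq_det :
    vandermondeProd R n =
      C (∏ i : Fin n, ∏ _j ∈ Ioi i, (-1)) *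
        (Matrix.vandermonde (X : Fin n → MvPolynomial (Fin n) R)).det := by
  simp only [vandermondeProd, Matrix.det_vandermonde, map_prod, map_neg, map_one,
    ← prod_mul_distrib, neg_one_mul, neg_sub]

theorem exists_det_X_pow_eq {c : Fin n → ℕ} (hc : ∑ i, c i = ∑ i ∈ range n, i) :
    ∃ a : R, (Matrix.of fun i j : Fin n => (X i : MvPolynomial (Fin n) R) ^ c j).det =
      C a * vandermondeProd R n := by
  by_cases hinj : Function.Injective c
  · have hcard : #(univ.image c) = n := by
      rw [card_image_of_injective _ hinj, card_univ, Fintype.card_fin]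
    have himage : univ.image c = range n := by
      have := eq_range_of_sum_eq_sum_range (s := univ.image c)
        (by rw [sum_image hinj.injOn, hcard, hc])
      rwa [hcard] at this
    have hlt : ∀ i, c i < n := fun i =>
      mem_range.mp (himage ▸ mem_image_of_mem c (mem_univ i))
    let τ : Equiv.Perm (Fin n) := Equiv.ofBijective (fun i => ⟨c i, hlt i⟩)
      (Finite.injective_iff_bijective.mp fun i j h => hinj (Fin.mk.inj h))
    refine ⟨Equiv.Perm.sign τ * ∏ i : Fin n, ∏ _j ∈ Ioi i, (-1), ?_⟩
    have hsign : (∏ i : Fin n, ∏ _j ∈ Ioi i, (-1 : R)) *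
        ∏ i : Fin n, ∏ _j ∈ Ioi i, (-1 : R) = 1 := by
      simp only [← prod_mul_distrib, mul_neg, mul_one, neg_neg, prod_const_one]
    calc (Matrix.of fun i j : Fin n => (X i : MvPolynomial (Fin n) R) ^ c j).det
        = ((Matrix.vandermonde (X : Fin n → MvPolynomial (Fin n) R)).submatrix id τ).det := rfl
      _ = (Equiv.Perm.sign τ : ℤ) *
          (Matrix.vandermonde (X : Fin n → MvPolynomial (Fin n) R)).det :=
        Matrix.det_permute' τ _
      _ = _ := by
        rw [vandermondeProd_eq_det, ← mul_assoc, ← C_mul, mul_assoc, hsign, mul_one, map_intCast]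
  · obtain ⟨i, j, hij, hne⟩ := Function.not_injective_iff.mp hinj
    refine ⟨0, ?_⟩
    rw [C_0, zero_mul]
    exact Matrix.det_zero_of_column_eq hne fun k => by simp only [Matrix.of_apply, hij]

theorem exists_antisymmetrize_eq {P : MvPolynomial (Fin n) R} (hP : P.IsHomogeneous (n.choose 2)) :
    ∃ a : R, antisymmetrize P = C a * vandermondeProd R n := by
  have hmonomial : ∀ c ∈ P.support, ∃ a : R,
      antisymmetrize (monomial c (coeff c P)) = C a * vandermondeProd R n := by
    intro c hc
    have hdeg : ∑ i, c i = ∑ i ∈ range n, i := by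
      rw [sum_range_id, ← Nat.choose_two_right, ← Finsupp.degree_eq_sum,
        Finsupp.degree_eq_weight_one]
      exact hP (mem_support_iff.mp hc)
    obtain ⟨a, ha⟩ := exists_det_X_pow_eq (R := R) hdeg
    exact ⟨coeff c P * a, by rw [antisymmetrize_monomial, ha, C_mul, mul_assoc]⟩
  choose! a ha using hmonomial
  refine ⟨∑ c ∈ P.support, a c, ?_⟩
  conv_lhs => rw [P.as_sum]
  rw [map_sum, map_sum, sum_mul, sum_congr rfl ha]

/-- The permutation of `Fin (n + 1)` sending `p` to `0` and acting as `e` between the complements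
of `p` and of `0`, each identified with `Fin n` in increasing order. -/
def consPerm (p : Fin (n + 1)) (e : Equiv.Perm (Fin n)) : Equiv.Perm (Fin (n + 1)) :=
  Equiv.Perm.decomposeFin.symm (0, e) * p.cycleRange

theorem consPerm_apply_self (p : Fin (n + 1)) (e : Equiv.Perm (Fin n)) : consPerm p e p = 0 := by
  simp [consPerm]

theorem consPerm_apply_succAbove (p : Fin (n + 1)) (e : Equiv.Perm (Fin n)) (j : Fin n) :
    consPerm p e (p.succAbove j) = (e j).succ := by
  simp [consPerm]

theorem sign_consPerm (p : Fin (n + 1)) (e : Equiv.Perm (Fin n)) :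
    Equiv.Perm.sign (consPerm p e) = (-1) ^ (p : ℕ) * Equiv.Perm.sign e := by
  rw [consPerm, Equiv.Perm.sign_mul, Equiv.Perm.decomposeFin.symm_sign, if_pos rfl, one_mul,
    Fin.sign_cycleRange, mul_comm]

theorem consPerm_bijective :
    Function.Bijective fun x : Fin (n + 1) × Equiv.Perm (Fin n) => consPerm x.1 x.2 := by
  refine (Fintype.bijective_iff_injective_and_card _).mpr ⟨?_, ?_⟩
  · rintro ⟨p, e⟩ ⟨p', e'⟩ h
    simp only at h
    obtain rfl : p = p' := (consPerm p e).injective <| by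
      rw [consPerm_apply_self, h, consPerm_apply_self]
    exact congrArg (Prod.mk p)
      (Prod.mk.inj (Equiv.Perm.decomposeFin.symm.injective (mul_right_cancel h))).2
  · rw [Fintype.card_prod, Fintype.card_perm, Fintype.card_perm, Fintype.card_fin,
      Fintype.card_fin, Nat.factorial_succ]

theorem bergeronSottile_zero_rename_consPerm (p : Fin (n + 1)) (e : Equiv.Perm (Fin n))
    (P : MvPolynomial (Fin (n + 1)) R) :
    bergeronSottile 0 (rename (consPerm p e) P) = rename e (bergeronSottile p P) := by
  suffices h : (bergeronSottile 0).comp (rename (R := R) (consPerm p e)) =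
      (rename e).comp (bergeronSottile p) from DFunLike.congr_fun h P
  refine algHom_ext fun i => ?_
  rcases Fin.eq_self_or_eq_succAbove p i with rfl | ⟨j, rfl⟩
  · simp [consPerm_apply_self]
  · have hbs := bergeronSottile_X_succAbove (R := R) 0 (e j)
    simpa [consPerm_apply_succAbove] using hbs

theorem bergeronSottile_zero_antisymmetrize (P : MvPolynomial (Fin (n + 1)) R) :
    bergeronSottile 0 (antisymmetrize P) =
      ∑ p : Fin (n + 1), (-1) ^ (p : ℕ) * antisymmetrize (bergeronSottile p P) := by
  simp only [antisymmetrize_apply, map_sum, map_mul, map_intCast, mul_sum]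
  rw [← consPerm_bijective.sum_comp, Fintype.sum_prod_type]
  refine sum_congr rfl fun p _ => sum_congr rfl fun e _ => ?_
  rw [sign_consPerm, bergeronSottile_zero_rename_consPerm, ← mul_assoc]
  push_cast
  rfl

end Antisymmetrization

section GapProd

variable {A : Type*} [CommRing A] {n : ℕ}

/-- The product of the `q xᵢ - xⱼ` over the non-adjacent pairs `i + 1 < j`: the numerator
`∏_{i<j} (q xᵢ - xⱼ)` of the divided symmetrization with its denominator cancelled. -/
def gapProd (q : A) (x : Fin n → A) : A :=
  ∏ i : Fin n, ∏ j : Fin n, if (i : ℕ) + 1 < j then q * x i - x j else 1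

theorem gapProd_of_le_two (hn : n ≤ 2) (q : A) (x : Fin n → A) : gapProd q x = 1 :=
  prod_eq_one fun i _ => prod_eq_one fun j _ => if_neg (by omega)

theorem gapProd_cons (q a : A) (x : Fin (n + 1) → A) :
    gapProd q (Fin.cons a x : Fin (n + 2) → A) =
      (∏ j : Fin n, (q * a - x j.succ)) * gapProd q x := by
  simp [gapProd, Fin.prod_univ_succ (n := n + 1), Fin.prod_univ_succ (n := n)]

theorem map_gapProd {B F : Type*} [CommRing B] [FunLike F A B] [RingHomClass F A B] (φ : F)
    (q : A) (x : Fin n → A) : φ (gapProd q x) = gapProd (φ q) (φ ∘ x) := by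
  simp only [gapProd, map_prod, apply_ite φ, map_sub, map_mul, map_one, Function.comp_apply]

theorem prod_Ioi_eq_mul_gapProd (q : A) (x : Fin (n + 1) → A) :
    ∏ i, ∏ j ∈ Ioi i, (q * x i - x j) =
      (∏ i : Fin n, (q * x i.castSucc - x i.succ)) * gapProd q x := by
  induction n with
  | zero => simp [gapProd_of_le_two]
  | succ n ih =>
    cases x using Fin.consCases with
    | _ a x =>
      let y : Fin (n + 2) → A := Fin.cons a x
      calc ∏ i, ∏ j ∈ Ioi i, (q * y i - y j)
          = (∏ j, (q * a - x j)) * ∏ i, ∏ j ∈ Ioi i, (q * x i - x j) := by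
            simp [y, Fin.prod_univ_succ (n := n + 1)]
        _ = _ := by
            rw [ih, gapProd_cons, Fin.prod_univ_succ (n := n), Fin.prod_univ_succ (n := n)]
            simp only [Fin.castSucc_zero, ← Fin.succ_castSucc, Fin.cons_zero, Fin.cons_succ]
            ring

theorem isHomogeneous_gapProd {σ R : Type*} [CommRing R] (q : R)
    {x : Fin (n + 1) → MvPolynomial σ R} (hx : ∀ i, (x i).IsHomogeneous 1) :
    (gapProd (C q) x).IsHomogeneous (n.choose 2) := by
  induction n with
  | zero => simpa [gapProd_of_le_two] using isHomogeneous_one σ R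
  | succ n ih =>
    cases x using Fin.consCases with
    | _ a x =>
      have hx' : ∀ i, (x i).IsHomogeneous 1 := fun i => hx i.succ
      have hfactor : (∏ j : Fin n, (C q * a - x j.succ)).IsHomogeneous n := by
        simpa using IsHomogeneous.prod univ _ (fun _ => 1) fun (j : Fin n) _ =>
          ((hx 0).C_mul q).sub (hx' j.succ)
      rw [gapProd_cons, Nat.choose_succ_succ' n 1, Nat.choose_one_right]
      exact hfactor.mul (ih hx')

theorem gapProd_cons_insertNth_succ_zero (q a : A) (z : Fin (n + 1) → A) (k : Fin (n + 1)) :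
    gapProd q (Fin.cons a (k.succ.insertNth 0 z : Fin (n + 2) → A)) =
      q * a * (∏ j : Fin n, (q * a - z j.succ)) * gapProd q (k.succ.insertNth 0 z) := by
  cases z using Fin.consCases with
  | _ b z =>
    rw [gapProd_cons, Fin.insertNth_succ_cons]
    simp [Fin.prod_univ_succAbove _ k]

theorem sum_gapProd_insertNth_zero_cons (q a : A) (z : Fin (n + 1) → A) (F : Fin (n + 3) → A) :
    ∑ p : Fin (n + 3), (-1) ^ (p : ℕ) *
        (gapProd q (p.insertNth 0 (Fin.cons a z : Fin (n + 2) → A)) * F p) =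
      (∏ j, -z j) * (∏ j : Fin n, (q * a - z j.succ)) * gapProd q z * F 0 -
        (∏ j, (q * a - z j)) * (∏ j : Fin n, -z j.succ) * gapProd q z * F 1 +
        q * a * (∏ j : Fin n, (q * a - z j.succ)) * ∑ k : Fin (n + 1),
          (-1) ^ (k : ℕ) * (gapProd q (k.succ.insertNth 0 z) * F k.succ.succ) := by
  have hzero : gapProd q (Fin.insertNth 0 0 (Fin.cons a z : Fin (n + 2) → A)) =
      (∏ j, -z j) * (∏ j : Fin n, (q * a - z j.succ)) * gapProd q z := by
    simp only [Fin.insertNth_zero', gapProd_cons, Fin.cons_succ, mul_zero, zero_sub, mul_assoc]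
  have hone : gapProd q ((Fin.succ 0).insertNth 0 (Fin.cons a z : Fin (n + 2) → A)) =
      (∏ j, (q * a - z j)) * (∏ j : Fin n, -z j.succ) * gapProd q z := by
    simp only [Fin.insertNth_succ_cons, Fin.insertNth_zero', gapProd_cons, Fin.cons_succ, mul_zero,
      zero_sub, mul_assoc]
  rw [Fin.sum_univ_succ, Fin.sum_univ_succ, hzero, hone, ← add_assoc, mul_sum]
  refine congrArg₂ _ ?_ (sum_congr rfl fun k _ => ?_)
  · simp only [Fin.val_zero, Fin.val_one, Fin.succ_zero_eq_one]
    ring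
  · rw [Fin.insertNth_succ_cons, gapProd_cons_insertNth_succ_zero, Fin.val_succ, Fin.val_succ]
    ring

theorem sum_gapProd_insertNth_zero (q : A) (z : Fin (n + 1) → A) (F : Fin (n + 2) → A) :
    ∑ p : Fin (n + 2), (-1) ^ (p : ℕ) * (gapProd q (p.insertNth 0 z) * F p) =
      (-1) ^ (n + 1) * gapProd q z * ∑ k : Fin (n + 1),
        q ^ (k : ℕ) * (∏ j, z (k.succAbove j)) * (F k.succ - F k.castSucc) := by
  induction n with
  | zero =>
    have hgap (m : ℕ) (hm : m ≤ 2) (x : Fin m → A) : gapProd q x = 1 := gapProd_of_le_two hm q x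
    rw [hgap _ (by omega)]
    simp [hgap, Fin.sum_univ_succ, sub_eq_add_neg]
  | succ n ih =>
    cases z using Fin.consCases with
    | _ a z =>
      set S := ∑ k : Fin (n + 1),
        (-1) ^ (k : ℕ) * (gapProd q (k.succ.insertNth 0 z) * F k.succ.succ) with hS
      set T := ∑ k : Fin (n + 1), q ^ (k : ℕ) * (∏ j, z (k.succAbove j)) *
        (F k.succ.succ - F k.castSucc.succ) with hT
      have hind : (∏ j : Fin n, -z j.succ) * gapProd q z * F 1 - S =
          (-1) ^ (n + 1) * gapProd q z * T := by
        rw [hT, ← ih z fun p => F p.succ, hS]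
        simp [Fin.sum_univ_succ (n := n + 1), gapProd_cons, pow_succ, sub_eq_add_neg]
      have hsum : ∑ k : Fin (n + 2), q ^ (k : ℕ) *
          (∏ j, (Fin.cons a z : Fin (n + 2) → A) (k.succAbove j)) * (F k.succ - F k.castSucc) =
          (∏ j, z j) * (F 1 - F 0) + q * a * T := by
        rw [Fin.sum_univ_succ, hT, mul_sum]
        refine congrArg₂ _ (by simp) (sum_congr rfl fun k _ => ?_)
        simp only [Fin.prod_univ_succ (n := n), Fin.succ_succAbove_zero, Fin.succ_succAbove_succ,
          Fin.cons_zero, Fin.cons_succ, Fin.val_succ, pow_succ, Fin.castSucc_succ]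
        ring
      rw [sum_gapProd_insertNth_zero_cons, hsum, gapProd_cons]
      simp only [prod_neg, card_univ, Fintype.card_fin, Fin.prod_univ_succ (n := n)] at hind ⊢
      linear_combination (-q * a * (∏ j : Fin n, (q * a - z j.succ))) * hind

end GapProd

section Recursion

theorem bergeronSottile_gapProd {R : Type*} [CommRing R] {n : ℕ} (q : R) (p : Fin (n + 1)) :
    bergeronSottile p (gapProd (C q) X) = gapProd (C q) (p.insertNth 0 X) := by
  have hX : (bergeronSottile p ∘ X : Fin (n + 1) → MvPolynomial (Fin n) R) = p.insertNth 0 X := by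
    funext i
    rcases Fin.eq_self_or_eq_succAbove p i with rfl | ⟨j, rfl⟩ <;> simp
  rw [map_gapProd, bergeronSottile_C, hX]

theorem bergeronSottile_zero_antisymmetrize_mul_gapProd {R : Type*} [CommRing R] {n : ℕ} (q : R)
    (f : MvPolynomial (Fin (n + 2)) R) :
    bergeronSottile 0 (antisymmetrize (f * gapProd (C q) X)) =
      (-1) ^ (n + 1) * (∏ j, X j) * antisymmetrize (qTrim q f * gapProd (C q) X) := by
  have hX (k : Fin (n + 1)) : (∏ j, X (k.succAbove j) : MvPolynomial (Fin (n + 1)) R) *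
      (bergeronSottile k.succ f - bergeronSottile k.castSucc f) = (∏ j, X j) * trim k f := by
    rw [← X_mul_trim, Fin.prod_univ_succAbove _ k]
    ring
  have hsum : ∑ p : Fin (n + 2), (-1) ^ (p : ℕ) * bergeronSottile p (f * gapProd (C q) X) =
      (-1) ^ (n + 1) * ((∏ j, X j) * (qTrim q f * gapProd (C q) X)) := by
    simp only [map_mul, bergeronSottile_gapProd, mul_comm (bergeronSottile _ f)]
    rw [sum_gapProd_insertNth_zero, qTrim_apply]
    simp only [mul_assoc, hX, smul_eq_C_mul, map_pow, mul_sum, sum_mul]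
    exact sum_congr rfl fun k _ => by ring
  have hsymm : (∏ j, X j : MvPolynomial (Fin (n + 1)) R).IsSymmetric := fun σ => by
    simpa using σ.prod_comp univ (X : _ → MvPolynomial (Fin (n + 1)) R)
  have hsign (p : ℕ) (P : MvPolynomial (Fin (n + 1)) R) :
      (-1) ^ p * antisymmetrize P = antisymmetrize ((-1) ^ p * P) :=
    (antisymmetrize_mul_of_isSymmetric ((symmetricSubalgebra _ R).pow_mem
      ((symmetricSubalgebra _ R).neg_mem (one_mem _)) p) P).symm
  rw [bergeronSottile_zero_antisymmetrize, mul_assoc, ← antisymmetrize_mul_of_isSymmetric hsymm]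
  simp only [hsign, ← map_sum, hsum]

theorem antisymmetrize_mul_gapProd {R : Type*} [CommRing R] [IsDomain R] (q : R) {n : ℕ}
    {f : MvPolynomial (Fin (n + 1)) R} (hf : f.IsHomogeneous n) :
    antisymmetrize (f * gapProd (C q) X) =
      C (trimFunctional q n f) * vandermondeProd R (n + 1) := by
  induction n with
  | zero =>
    have hconst : f = C (coeff 0 f) :=
      totalDegree_eq_zero_iff_eq_C.mp (Nat.le_zero.mp hf.totalDegree_le)
    rw [gapProd_of_le_two (by omega), mul_one, hconst, antisymmetrize_apply]
    simp [vandermondeProd, trimFunctional]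
  | succ n ih =>
    obtain ⟨a, ha⟩ := exists_antisymmetrize_eq (P := f * gapProd (C q) X) (by
      rw [Nat.choose_succ_succ' (n + 1) 1, Nat.choose_one_right]
      exact hf.mul (isHomogeneous_gapProd q (isHomogeneous_X R)))
    have hnonzero : (-1) ^ (n + 1) * (∏ j, X j) * vandermondeProd R (n + 1) ≠ 0 :=
      mul_ne_zero (mul_ne_zero (pow_ne_zero _ (neg_ne_zero.mpr one_ne_zero))
        (prod_ne_zero_iff.mpr fun j _ => X_ne_zero j)) vandermondeProd_ne_zero
    have hconst : (C a : MvPolynomial (Fin (n + 1)) R) = C (trimFunctional q n (qTrim q f)) := by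
      refine mul_right_cancel₀ hnonzero ?_
      have hrec := bergeronSottile_zero_antisymmetrize_mul_gapProd q f
      rw [ha, ih (isHomogeneous_qTrim q hf), map_mul, bergeronSottile_zero_vandermondeProd,
        bergeronSottile_C] at hrec
      rw [hrec]
      ring
    rw [ha, trimFunctional_succ, C_injective _ _ hconst]

end Recursion

section RationalFunctions

variable {K : Type*} [Field K] {n : ℕ}

theorem permAct_algebraMap (σ : Equiv.Perm (Fin n)) (P : MvPolynomial (Fin n) K) :
    permAct K σ (algebraMap (MvPolynomial (Fin n) K) (RatFun K n) P) =
      algebraMap (MvPolynomial (Fin n) K) (RatFun K n) (rename σ P) :=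
  IsFractionRing.ringEquivOfRingEquiv_algebraMap _ _

theorem dividedDiffLongest_algebraMap (P : MvPolynomial (Fin n) K) :
    dividedDiffLongest (algebraMap (MvPolynomial (Fin n) K) (RatFun K n) P) =
      algebraMap (MvPolynomial (Fin n) K) (RatFun K n) (antisymmetrize P) /
        algebraMap (MvPolynomial (Fin n) K) (RatFun K n) (vandermondeProd K n) := by
  simp only [dividedDiffLongest, permAct_algebraMap, antisymmetrize_apply, vandermondeProd, map_sum,
    map_mul, map_prod, map_sub, map_intCast, ratX]

theorem C_mul_X_sub_X_ne_zero (q : K) {i j : Fin n} (h : i ≠ j) :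
    (C q * X i - X j : MvPolynomial (Fin n) K) ≠ 0 := by
  have hsingle : Finsupp.single i 1 ≠ Finsupp.single j 1 :=
    (Finsupp.single_left_inj one_ne_zero).not.mpr h
  refine ne_zero_iff.mpr ⟨Finsupp.single j 1, ?_⟩
  simp [coeff_C_mul, coeff_X, hsingle]

theorem qds_eq_trimFunctional (q : K) {f : MvPolynomial (Fin (n + 1)) K} (hf : f.IsHomogeneous n) :
    qds q f = algebraMap (MvPolynomial (Fin (n + 1)) K) (RatFun K (n + 1))
      (C (trimFunctional q n f)) := by
  set ι := algebraMap (MvPolynomial (Fin (n + 1)) K) (RatFun K (n + 1)) with hι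
  have hinj : Function.Injective ι := IsFractionRing.injective _ _
  set D : MvPolynomial (Fin (n + 1)) K := ∏ i : Fin n, (C q * X i.castSucc - X i.succ) with hD
  have hD0 : ι D ≠ 0 := (map_ne_zero_iff _ hinj).mpr <|
    prod_ne_zero_iff.mpr fun _ _ => C_mul_X_sub_X_ne_zero q Fin.castSucc_lt_succ.ne
  have hV0 : ι (vandermondeProd K (n + 1)) ≠ 0 :=
    (map_ne_zero_iff _ hinj).mpr vandermondeProd_ne_zero
  have hden : (∏ i : Fin (n + 1 - 1), qForm q (⟨i, by omega⟩ : Fin (n + 1)) ⟨i + 1, by omega⟩) =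
      ι D := by
    rw [hD, map_prod]
    rfl
  have hnum : ∏ i : Fin (n + 1), ∏ j ∈ Ioi i, qForm q i j = ι D * ι (gapProd (C q) X) := by
    rw [← map_mul, ← prod_Ioi_eq_mul_gapProd]
    simp only [map_prod]
    rfl
  calc qds q f = dividedDiffLongest (ι (f * gapProd (C q) X)) := by
        rw [qds, squareLongest, hden, hnum, map_mul, ← hι]
        field_simp
    _ = ι (C (trimFunctional q n f)) := by
        rw [dividedDiffLongest_algebraMap, antisymmetrize_mul_gapProd q hf, map_mul,
          mul_div_cancel_right₀ _ hV0]

end RationalFunctions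

theorem theorem5p6_general {K : Type*} [Field K] (q : K) (n : ℕ) (hn : 0 < n) :
    (∀ f g h : MvPolynomial (Fin n) K, f.IsHomogeneous (n - 1) →
      g ∈ abbSpan K n → h ∈ qsymPlus K n → f = g + h →
      qds q f =
        algebraMap (MvPolynomial (Fin n) K) (RatFun K n)
          (MvPolynomial.C (MvPolynomial.eval (fun i : Fin n => q ^ (i : ℕ)) g))) ∧
    (∀ (c : Fin n →₀ ℕ) (hc : c ∈ abbSet n) (hdeg : ∑ i, c i = n - 1),
      qds q (MvPolynomial.monomial c (1 : K)) =
        algebraMap (MvPolynomial (Fin n) K) (RatFun K n)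
          (MvPolynomial.C (q ^ coarea (abbDyck c hc hdeg)))) := by
  obtain ⟨n, rfl⟩ := Nat.exists_eq_add_one.mpr hn
  have heval : ∀ f g h : MvPolynomial (Fin (n + 1)) K, f.IsHomogeneous n →
      g ∈ abbSpan K (n + 1) → h ∈ qsymPlus K (n + 1) → f = g + h →
      qds q f = algebraMap (MvPolynomial (Fin (n + 1)) K) (RatFun K (n + 1))
        (C (eval (fun i : Fin (n + 1) => q ^ (i : ℕ)) g)) := fun f g h hf hg hh hfgh => by
    rw [qds_eq_trimFunctional q hf, trimFunctional_eq_eval_of_eq_add q hf hg hh hfgh]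
  refine ⟨heval, fun c hc hdeg => ?_⟩
  have hhom : (monomial c (1 : K)).IsHomogeneous n :=
    isHomogeneous_monomial _ ((Finsupp.degree_eq_sum c).trans hdeg)
  have hspan : monomial c (1 : K) ∈ abbSpan K (n + 1) := Submodule.subset_span ⟨c, hc, rfl⟩
  rw [heval _ _ 0 hhom hspan (zero_mem _) (add_zero _).symm, eval_monomial_eq_pow_coarea q hc hdeg]

theorem theorem5p6 {K : Type*} [Field K] [CharZero K] (q : K)
    (hq : ∀ m : ℕ, 0 < m → q ^ m = 1 → q = 1) (n : ℕ) (hn : 0 < n) :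
    (∀ f g h : MvPolynomial (Fin n) K, f.IsHomogeneous (n - 1) →
      g ∈ abbSpan K n → h ∈ qsymPlus K n → f = g + h →
      qds q f =
        algebraMap (MvPolynomial (Fin n) K) (RatFun K n)
          (MvPolynomial.C (MvPolynomial.eval (fun i : Fin n => q ^ (i : ℕ)) g))) ∧
    (∀ (c : Fin n →₀ ℕ) (hc : c ∈ abbSet n) (hdeg : ∑ i, c i = n - 1),
      qds q (MvPolynomial.monomial c (1 : K)) =
        algebraMap (MvPolynomial (Fin n) K) (RatFun K n)
          (MvPolynomial.C (q ^ coarea (abbDyck c hc hdeg)))) :=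
  theorem5p6_general q n hn
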